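/- **Definitions.** For a lattice $L$ and $u=\langle x,y,z\rangle\in L^3$ put $u^{(0)}=u$, $u^{(1)}=\langle x\vee(y\wedge z),\,y\vee(x\wedge z),\,z\vee(x\wedge y)\rangle$ and $u^{(k+1)}=(u^{(k)})^{(1)}$. For a positive integer $h$, $L$ is *$h$-modular* if $u^{(h+1)}=u^{(h)}$ for all $u\in L^3$; $\mathbf{M}^h$ is the class of all $h$-modular lattices. A lattice is *locally finite* if each of its finite subsets generates a finite sublattice, and *three-generated* if it is generated by a three-element subset. Let $A$, $B$ be $\{\vee,0\}$-semilattices and $\bot_{A,B}=(A\times\{0_B\})\cup(\{0_A\}\times B)$. A *bi-ideal* of $A\times B$ is a hereditary (downward closed) subset $I\supseteq\bot_{A,B}$ closed under lateral joins: $\langle a_0,b\rangle,\langle a_1,b\rangle\in I$ implies $\langle a_0\vee a_1,b\rangle\in I$, and $\langle a,b_0\rangle,\langle a,b_1\rangle\in I$ implies $\langle a,b_0\vee b_1\rangle\in I$. Then $A\otimes B$ is the set of compact elements of the complete lattice of all bi-ideals of $A\times B$ (ordered by inclusion). A bi-ideal is *capped* if it is the hereditary subset of $A\times B$ generated by $\Gamma\cup\bot_{A,B}$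 for some finite $\Gamma\subseteq A\times B$, and $A\otimes B$ is a *capped tensor product* if all its elements are capped. A lattice $A$ with zero is *$\mathbf{M}^h$-amenable* if $A\otimes L$ is a capped tensor product for every $h$-modular lattice $L$ with zero. Let $K$ be the lattice whose distinct elements are $0$, $c$, and $a_n$, $b_n$, $a_n\vee b_n$, $a_n\vee c$, $b_n\vee c$ for $n<\omega$. Its order is determined as follows. The nonzero join-irreducible elements are $c$, $a_n$, $b_n$ ($n<\omega$), and the only comparabilities among them are $a_m\leqslant a_n$ and $b_m\leqslant b_n$ for $m\geqslant n$, and $c\leqslant c$. The sets of join-irreducible elements below the other nonzero elements are: below $a_n\vee b_n$, the elements $c$, $a_m$ and $b_m$ for $m\geqslant n$; below $a_n\vee c$ (which equals $a_n\vee b_{n+1}$), the elements $c$, $a_m$ for $m\geqslant n$ and $b_m$ for $m\geqslant n+1$; below $b_n\vee c$ (which equals $a_{n+1}\vee b_n$), the elements $c$, $a_m$ for $m\geqslant n+1$ and $b_m$ for $m\geqslant n$. One has $u\leqslant v$ in $K$ if and only if every nonzero join-irreducible element below $u$ is below $v$. **Theorem.** The lattice $K$ has the following properties: 1. $K$ is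 infinite, three-generated and $2$-modular. 2. $K$ is $\mathbf{M}^h$-amenable for every integer $h>0$; that is, $K\otimes L$ is a capped tensor product for every $h$-modular lattice $L$ with zero. 3. $K$ is not locally finite. -/

import Mathlib

universe u

namespace CappedTensor

/-! ### Triples, `h`-modularity, generation, local finiteness -/

/-- The map `⟨x, y, z⟩ ↦ ⟨x ∨ (y ∧ z), y ∨ (x ∧ z), z ∨ (x ∧ y)⟩` on triples of a lattice. -/
def tripleStep {L : Type*} [Lattice L] (u : L × L × L) : L × L × L :=
  (u.1 ⊔ (u.2.1 ⊓ u.2.2), u.2.1 ⊔ (u.1 ⊓ u.2.2), u.2.2 ⊔ (u.1 ⊓ u.2.1))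

/-- A lattice is `h`-modular if `u^(h+1) = u^(h)` for every triple `u`. -/
def IsHModular (h : ℕ) (L : Type*) [Lattice L] : Prop :=
  ∀ u : L × L × L, tripleStep^[h + 1] u = tripleStep^[h] u

/-- A lattice is `n`-generated if it is generated, as a lattice, by some `n`-element subset. -/
def IsNGenerated (n : ℕ) (L : Type*) [Lattice L] : Prop :=
  ∃ s : Finset L, s.card = n ∧ latticeClosure (s : Set L) = Set.univ

/-- A lattice is locally finite if every finite subset generates a finite sublattice. -/
def IsLocallyFinite (L : Type*) [Lattice L] : Prop :=
  ∀ s : Set L, s.Finite → (latticeClosure s).Finite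

/-! ### Bi-ideals and tensor products of join-semilattices with zero -/

section Tensor

/-- The set `⊥_{A,B} = (A × {0}) ∪ ({0} × B)`. -/
def botSet (A B : Type*) [SemilatticeSup A] [OrderBot A] [SemilatticeSup B] [OrderBot B] :
    Set (A × B) :=
  {p | p.2 = ⊥} ∪ {p | p.1 = ⊥}

/-- A bi-ideal of `A × B`: a hereditary subset that contains `⊥_{A,B}` and is closed under
lateral joins. -/
structure BiIdeal (A B : Type*) [SemilatticeSup A] [OrderBot A] [SemilatticeSup B]
    [OrderBot B] where
  carrier : Set (A × B)
  lower : IsLowerSet carrier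
  botSet_subset : botSet A B ⊆ carrier
  sup_left : ∀ a₀ a₁ b, (a₀, b) ∈ carrier → (a₁, b) ∈ carrier → (a₀ ⊔ a₁, b) ∈ carrier
  sup_right : ∀ a b₀ b₁, (a, b₀) ∈ carrier → (a, b₁) ∈ carrier → (a, b₀ ⊔ b₁) ∈ carrier

variable {A B : Type*} [SemilatticeSup A] [OrderBot A] [SemilatticeSup B] [OrderBot B]

theorem BiIdeal.carrier_injective :
    Function.Injective (BiIdeal.carrier : BiIdeal A B → Set (A × B)) := by
  rintro ⟨I, _, _, _, _⟩ ⟨J, _, _, _, _⟩ (h : I = J)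
  subst h
  rfl

/-- Bi-ideals are ordered by inclusion. -/
instance : PartialOrder (BiIdeal A B) where
  le I J := I.carrier ⊆ J.carrier
  le_refl _ := subset_rfl
  le_trans _ _ _ h₁ h₂ := Set.Subset.trans h₁ h₂
  le_antisymm _ _ h₁ h₂ := BiIdeal.carrier_injective (Set.Subset.antisymm h₁ h₂)

/-- The infimum of a set of bi-ideals is their intersection. -/
instance : InfSet (BiIdeal A B) where
  sInf S :=
    { carrier := {p | ∀ I ∈ S, p ∈ I.carrier}
      lower := fun _ _ hpq hp I hI => I.lower hpq (hp I hI)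
      botSet_subset := fun _ hp I _ => I.botSet_subset hp
      sup_left := fun _ _ _ h₀ h₁ I hI => I.sup_left _ _ _ (h₀ I hI) (h₁ I hI)
      sup_right := fun _ _ _ h₀ h₁ I hI => I.sup_right _ _ _ (h₀ I hI) (h₁ I hI) }

theorem BiIdeal.isGLB_sInf (S : Set (BiIdeal A B)) : IsGLB S (sInf S) :=
  ⟨fun I hI _ hp => hp I hI, fun _ hJ _ hp _ hI => hJ hI hp⟩

/-- The extended tensor product of `A` and `B`: the complete lattice of all bi-ideals. -/
instance : CompleteLattice (BiIdeal A B) :=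
  completeLatticeOfInf (BiIdeal A B) BiIdeal.isGLB_sInf

/-- `Γ` is a capping of `I` if `I` is the hereditary subset of `A × B` generated by
`Γ ∪ ⊥_{A,B}`. -/
def BiIdeal.IsCapping (I : BiIdeal A B) (Γ : Set (A × B)) : Prop :=
  I.carrier = (lowerClosure (Γ ∪ botSet A B) : Set (A × B))

/-- A bi-ideal is capped if it has a finite capping. -/
def BiIdeal.IsCapped (I : BiIdeal A B) : Prop :=
  ∃ Γ : Set (A × B), Γ.Finite ∧ I.IsCapping Γ

/-- The tensor product of `A` and `B`: the compact elements of the extended tensor product. -/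
def Tensor (A B : Type*) [SemilatticeSup A] [OrderBot A] [SemilatticeSup B] [OrderBot B] :
    Type _ :=
  {I : BiIdeal A B // IsCompactElement I}

/-- `A ⊗ B` is a capped tensor product if all its elements are capped bi-ideals. -/
def IsCappedTensor (A B : Type*) [SemilatticeSup A] [OrderBot A] [SemilatticeSup B]
    [OrderBot B] : Prop :=
  ∀ I : Tensor A B, I.1.IsCapped

/-- `A` is `V`-amenable, for a class `V` of lattices, if `A ⊗ L` is a capped tensor product for
every lattice `L` with zero in `V`. -/
def IsAmenableFor.{w, v} (V : ∀ (L : Type w) [Lattice L], Prop) (A : Type v) [Lattice A]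
    [OrderBot A] : Prop :=
  ∀ (L : Type w) [Lattice L] [OrderBot L], V L → IsCappedTensor A L

end Tensor

/-! ### The lattice `K`

`K` consists of a zero, two disjoint descending chains `a 0 > a 1 > ⋯` and `b 0 > b 1 > ⋯`, an
atom `c`, and the joins `ab n = a n ∨ b n`, `ac n = a n ∨ c = a n ∨ b (n + 1)`,
`bc n = b n ∨ c = a (n + 1) ∨ b n`, which form the descending ladder
`ab n > ac n, bc n > ab (n + 1)` with `ac n ∧ bc n = ab (n + 1)`. -/

/-- The underlying set of `K`. -/
inductive K : Type
  | zero : K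
  | a (n : ℕ) : K
  | b (n : ℕ) : K
  | c : K
  | ab (n : ℕ) : K
  | ac (n : ℕ) : K
  | bc (n : ℕ) : K

namespace K

/-- The ordering of `K`. -/
def le : K → K → Prop
  | zero, _ => True
  | a m, a n => n ≤ m
  | a m, ab n => n ≤ m
  | a m, ac n => n ≤ m
  | a m, bc n => n + 1 ≤ m
  | b m, b n => n ≤ m
  | b m, ab n => n ≤ m
  | b m, ac n => n + 1 ≤ m
  | b m, bc n => n ≤ m
  | c, c => True
  | c, ab _ => True
  | c, ac _ => True
  | c, bc _ => True
  | ab m, ab n => n ≤ m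
  | ab m, ac n => n + 1 ≤ m
  | ab m, bc n => n + 1 ≤ m
  | ac m, ab n => n ≤ m
  | ac m, ac n => n ≤ m
  | ac m, bc n => n + 1 ≤ m
  | bc m, ab n => n ≤ m
  | bc m, ac n => n + 1 ≤ m
  | bc m, bc n => n ≤ m
  | _, _ => False

/-- The join of `a i` and `b j`. -/
def join (i j : ℕ) : K :=
  if i = j then ab i else if i < j then ac i else bc j

/-- The join operation of `K`; note that `ab n = join n n`, `ac n = join n (n + 1)` and
`bc n = join (n + 1) n`. -/
def sup : K → K → K
  | zero, y => y
  | x, zero => x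
  | a m, a n => a (min m n)
  | a m, b n => join m n
  | a m, c => ac m
  | a m, ab n => join (min m n) n
  | a m, ac n => join (min m n) (n + 1)
  | a m, bc n => join (min m (n + 1)) n
  | b m, a n => join n m
  | b m, b n => b (min m n)
  | b m, c => bc m
  | b m, ab n => join n (min m n)
  | b m, ac n => join n (min m (n + 1))
  | b m, bc n => join (n + 1) (min m n)
  | c, a n => ac n
  | c, b n => bc n
  | c, y => y
  | ab m, a n => join (min m n) m
  | ab m, b n => join m (min m n)
  | ab m, c => ab m
  | ab m, ab n => ab (min m n)
  | ab m, ac n => join (min m n) (min m (n + 1))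
  | ab m, bc n => join (min m (n + 1)) (min m n)
  | ac m, a n => join (min m n) (m + 1)
  | ac m, b n => join m (min (m + 1) n)
  | ac m, c => ac m
  | ac m, ab n => join (min m n) (min (m + 1) n)
  | ac m, ac n => ac (min m n)
  | ac m, bc n => join (min m (n + 1)) (min (m + 1) n)
  | bc m, a n => join (min (m + 1) n) m
  | bc m, b n => join (m + 1) (min m n)
  | bc m, c => bc m
  | bc m, ab n => join (min (m + 1) n) (min m n)
  | bc m, ac n => join (min (m + 1) n) (min m (n + 1))
  | bc m, bc n => bc (min m n)

/-- The meet operation of `K`. -/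
def inf : K → K → K
  | a m, a n => a (max m n)
  | a m, ab n => a (max m n)
  | a m, ac n => a (max m n)
  | a m, bc n => a (max m (n + 1))
  | b m, b n => b (max m n)
  | b m, ab n => b (max m n)
  | b m, ac n => b (max m (n + 1))
  | b m, bc n => b (max m n)
  | c, c => c
  | c, ab _ => c
  | c, ac _ => c
  | c, bc _ => c
  | ab m, a n => a (max m n)
  | ab m, b n => b (max m n)
  | ab _, c => c
  | ab m, ab n => ab (max m n)
  | ab m, ac n => join (max m n) (max m (n + 1))
  | ab m, bc n => join (max m (n + 1)) (max m n)
  | ac m, a n => a (max m n)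
  | ac m, b n => b (max (m + 1) n)
  | ac _, c => c
  | ac m, ab n => join (max m n) (max (m + 1) n)
  | ac m, ac n => ac (max m n)
  | ac m, bc n => join (max m (n + 1)) (max (m + 1) n)
  | bc m, a n => a (max (m + 1) n)
  | bc m, b n => b (max m n)
  | bc _, c => c
  | bc m, ab n => join (max (m + 1) n) (max m n)
  | bc m, ac n => join (max (m + 1) n) (max m (n + 1))
  | bc m, bc n => bc (max m n)
  | _, _ => zero

theorem le_refl' (x : K) : le x x := by
  cases x <;> simp [le]

theorem le_trans' (x y z : K) (h₁ : le x y) (h₂ : le y z) : le x z := by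
  cases x <;> cases y <;> first
    | exact h₁.elim
    | (cases z <;> simp only [le] at h₁ h₂ ⊢ <;> omega)

theorem le_antisymm' (x y : K) (h₁ : le x y) (h₂ : le y x) : x = y := by
  cases x <;> cases y <;> simp only [le] at h₁ h₂ <;> first
    | rfl
    | (congr 1; omega)

theorem le_sup_left' (x y : K) : le x (sup x y) := by
  cases x <;> cases y <;> simp only [sup, join] <;> (try split_ifs) <;> simp only [le] <;> omega

theorem sup_comm' (x y : K) : sup x y = sup y x := by
  cases x <;> cases y <;> simp only [sup, min_comm]

theorem sup_le' (x y z : K) (h₁ : le x z) (h₂ : le y z) : le (sup x y) z := by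
  cases x <;> cases z <;> first
    | exact h₁.elim
    | (cases y <;> first
        | exact h₂.elim
        | (simp only [sup, join]; (try split_ifs) <;> simp only [le] at h₁ h₂ ⊢ <;> omega))

theorem inf_le_left' (x y : K) : le (inf x y) x := by
  cases x <;> cases y <;> simp only [inf, join] <;> (try split_ifs) <;> simp only [le] <;> omega

theorem inf_comm' (x y : K) : inf x y = inf y x := by
  cases x <;> cases y <;> simp only [inf, max_comm]

theorem le_inf' (x y z : K) (h₁ : le x y) (h₂ : le x z) : le x (inf y z) := by
  cases x <;> cases y <;> first
    | exact h₁.elim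
    | (cases z <;> first
        | exact h₂.elim
        | (simp only [inf, join]; (try split_ifs) <;> simp only [le] at h₁ h₂ ⊢ <;> omega))

instance : Lattice K where
  le := le
  le_refl := le_refl'
  le_trans := le_trans'
  le_antisymm := le_antisymm'
  sup := sup
  le_sup_left := le_sup_left'
  le_sup_right x y := by rw [sup_comm']; exact le_sup_left' y x
  sup_le := sup_le'
  inf := inf
  inf_le_left := inf_le_left'
  inf_le_right x y := by rw [inf_comm']; exact inf_le_left' y x
  le_inf := le_inf'

instance : OrderBot K where
  bot := zero
  bot_le _ := trivial

end K

end CappedTensor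

/-!
The point is amenability: a compact bi-ideal `I` of `K × L` is generated by a finite set, and the
process closing this set under lateral joins must stop after finitely many steps. Since every
element of `K` is a finite join of join-irreducible elements, `I` is determined by its largest
second coordinates `x n`, `y n`, `z` over `a n`, `b n`, `c`. The generators provide lower bounds
`α n`, `β n`, `γ` for them, where `α` and `β` are increasing and eventually constant, say from `N`
on (`exists_eventually_const_coeff`). The nontrivial join relations of `K` are `c ≤ a m ∨ b n`,
`a (n + 1) ≤ b n ∨ c` and `b (n + 1) ≤ a n ∨ c`; far out in the two chains, one round of closing
under them is exactly one application of `tripleStep` to the triple of tail values. As `L` is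
`h`-modular, the triple of tail values becomes stationary after `h` rounds, which gives the final
`z`. With `z` known, `x` and `y` are computed recursively (`climb`), they reach their limits at
index `N + h` (`climb_le`, `iterate_tripleStep_le_climb`), and the result satisfies all join
relations, so it defines a bi-ideal (`IsSaturated.biIdeal`), which is `I`. It is capped because
the sequences are eventually constant while the elements of `K` decrease with their index
(`isCapped_of_le_biIdeal`).

For `2`-modularity, a triple with two comparable entries stabilizes within two steps in every
lattice (`stabilizesInTwo_of_le`), and the three-element antichains of `K` are few enough to be
treated directly. The elements `a 0`, `b 0`, `c` generate `K`, as `a (n + 1) = a 0 ∧ (b n ∨ c)`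
and `b (n + 1) = b 0 ∧ (a n ∨ c)`.
-/

namespace CappedTensor

/-! ### Stabilization of triples in an arbitrary lattice -/

section Triples

variable {L : Type*} [Lattice L]

theorem le_tripleStep (u : L × L × L) : u ≤ tripleStep u :=
  ⟨le_sup_left, le_sup_left, le_sup_left⟩

/-- The `h`-modular law at the single triple `⟨x, y, z⟩`, for `h = 2`. -/
def StabilizesInTwo (x y z : L) : Prop :=
  tripleStep^[3] (x, y, z) = tripleStep^[2] (x, y, z)

theorem StabilizesInTwo.rotate {x y z : L} (h : StabilizesInTwo x y z) :
    StabilizesInTwo y z x := by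
  simp only [StabilizesInTwo, tripleStep, Function.iterate_succ, Function.iterate_zero,
    Function.comp_apply, id_eq, Prod.mk.injEq] at h ⊢
  simpa only [inf_comm, and_comm, and_left_comm, and_assoc] using h

theorem StabilizesInTwo.swap {x y z : L} (h : StabilizesInTwo x y z) :
    StabilizesInTwo y x z := by
  simp only [StabilizesInTwo, tripleStep, Function.iterate_succ, Function.iterate_zero,
    Function.comp_apply, id_eq, Prod.mk.injEq] at h ⊢
  simpa only [inf_comm, and_comm, and_left_comm, and_assoc] using h

/-- In every lattice, two steps suffice for a triple with two comparable entries; so for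
`2`-modularity only three-element antichains matter. -/
theorem stabilizesInTwo_of_le {x y : L} (z : L) (h : x ≤ y) : StabilizesInTwo x y z := by
  have e₁ : tripleStep (x, y, z) = (x ⊔ y ⊓ z, y, z ⊔ x) := by
    simp only [tripleStep, Prod.mk.injEq, true_and]
    exact ⟨sup_eq_left.2 (inf_le_left.trans h), by rw [inf_eq_left.2 h]⟩
  have e₂ : tripleStep (x ⊔ y ⊓ z, y, z ⊔ x) = (y ⊓ (z ⊔ x), y, z ⊔ x) := by
    have h₁ : x ⊔ y ⊓ z ≤ y := sup_le h inf_le_left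
    have h₂ : x ⊔ y ⊓ z ≤ z ⊔ x := sup_le le_sup_right (inf_le_right.trans le_sup_left)
    simp only [tripleStep, Prod.mk.injEq]
    exact ⟨sup_eq_right.2 (le_inf h₁ h₂), sup_eq_left.2 (inf_le_left.trans h₁),
      sup_eq_left.2 (inf_le_left.trans h₂)⟩
  have e₃ : tripleStep (y ⊓ (z ⊔ x), y, z ⊔ x) = (y ⊓ (z ⊔ x), y, z ⊔ x) := by
    simp only [tripleStep, Prod.mk.injEq]
    exact ⟨sup_idem _, sup_eq_left.2 (inf_le_left.trans inf_le_left),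
      sup_eq_left.2 (inf_le_left.trans inf_le_right)⟩
  simp only [StabilizesInTwo, Function.iterate_succ, Function.iterate_zero,
    Function.comp_apply, id_eq, e₁, e₂, e₃]

theorem stabilizesInTwo_of_tripleStep_eq {x y z x' y' z' : L}
    (h : tripleStep (x, y, z) = (x', y', z')) (h' : tripleStep^[2] (x', y', z') =
      tripleStep (x', y', z')) : StabilizesInTwo x y z := by
  simp only [Function.iterate_succ_apply, Function.iterate_zero_apply] at h'
  simp only [StabilizesInTwo, Function.iterate_succ_apply, Function.iterate_zero_apply, h, h']

theorem iterate_two_tripleStep_of_le_of_le {x y z : L} (hx : z ≤ x) (hy : z ≤ y) :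
    tripleStep^[2] (x, y, z) = tripleStep (x, y, z) := by
  have e : tripleStep (x, y, z) = (x, y, x ⊓ y) := by
    simp [tripleStep, hx, hy]
  simp only [Function.iterate_succ_apply', Function.iterate_zero_apply, e]
  simp [tripleStep]

theorem iterate_two_tripleStep_of_le_of_le' {x y z : L} (hyz : y ≤ z) (hzx : z ≤ x) :
    tripleStep^[2] (x, y, z) = tripleStep (x, y, z) := by
  have e : tripleStep (x, y, z) = (x, z, z) := by
    simp [tripleStep, inf_eq_right.2 hzx, hyz, hyz.trans hzx]
  simp only [Function.iterate_succ_apply', Function.iterate_zero_apply, e]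
  simp [tripleStep, hzx]

end Triples

/-! ### Order and joins of `K` -/

namespace K

theorem le_iff (x y : K) : x ≤ y ↔ K.le x y := Iff.rfl
theorem sup_eq (x y : K) : x ⊔ y = K.sup x y := rfl
theorem inf_eq (x y : K) : x ⊓ y = K.inf x y := rfl

theorem antitone_a : Antitone a := fun _ _ h => h
theorem antitone_b : Antitone b := fun _ _ h => h

theorem c_le_sup {x y : K} (h : c ≤ x ⊔ y) :
    c ≤ x ∨ c ≤ y ∨ ∃ m n, a m ≤ x ∧ b n ≤ y ∨ b n ≤ x ∧ a m ≤ y := by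
  cases x <;> cases y <;> first
    | exact Or.inl trivial
    | exact Or.inr (Or.inl trivial)
    | exact h.elim
    | exact Or.inr (Or.inr ⟨_, _, Or.inl ⟨le_refl _, le_refl _⟩⟩)
    | exact Or.inr (Or.inr ⟨_, _, Or.inr ⟨le_refl _, le_refl _⟩⟩)

/-- Besides the trivial reasons, `a (m + 1)` is below a join because `a (m + 1) ≤ b m ∨ c`. Only the
join, not one of its two arguments, is claimed to be above `c`: for example `a 1 ≤ a 2 ∨ b 0`,
because `c ≤ a 2 ∨ b 0`. -/
theorem a_le_sup {n : ℕ} {x y : K} (h : a n ≤ x ⊔ y) :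
    a n ≤ x ∨ a n ≤ y ∨ ∃ m, m + 1 = n ∧ c ≤ x ⊔ y ∧ (b m ≤ x ∨ b m ≤ y) := by
  rcases n with _ | n
  · simp only [le_iff, sup_eq] at h ⊢
    cases x <;> cases y <;> simp only [sup, join] at h <;> (try split_ifs at h) <;>
      simp only [le] at h ⊢ <;> omega
  · simp only [le_iff, sup_eq, Nat.add_right_cancel_iff, exists_eq_left] at h ⊢
    cases x <;> cases y <;> simp only [sup, join] at h ⊢ <;> (try split_ifs at h ⊢) <;>
      simp only [le, true_and, false_or, or_false] at h ⊢ <;> omega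

/-- The mirror image of `a_le_sup`. -/
theorem b_le_sup {n : ℕ} {x y : K} (h : b n ≤ x ⊔ y) :
    b n ≤ x ∨ b n ≤ y ∨ ∃ m, m + 1 = n ∧ c ≤ x ⊔ y ∧ (a m ≤ x ∨ a m ≤ y) := by
  rcases n with _ | n
  · simp only [le_iff, sup_eq] at h ⊢
    cases x <;> cases y <;> simp only [sup, join] at h <;> (try split_ifs at h) <;>
      simp only [le] at h ⊢ <;> omega
  · simp only [le_iff, sup_eq, Nat.add_right_cancel_iff, exists_eq_left] at h ⊢
    cases x <;> cases y <;> simp only [sup, join] at h ⊢ <;> (try split_ifs at h ⊢) <;>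
      simp only [le, true_and, false_or, or_false] at h ⊢ <;> omega

/-! ### `2`-modularity of `K` -/

theorem stabilizesInTwo_a_b_c (m n : ℕ) : StabilizesInTwo (a m) (b n) c := by
  have e : tripleStep (a m, b n, c) = (a m, b n, c) := rfl
  simp only [StabilizesInTwo, Function.iterate_succ_apply', Function.iterate_zero_apply, e]

theorem join_le_join {i j i' j' : ℕ} (hi : i' ≤ i) (hj : j' ≤ j) : join i j ≤ join i' j' := by
  simp only [le_iff, join]
  split_ifs <;> simp only [le] <;> omega

/-- For `|i - j| ≤ 1`, `join i j` is the general element of the ladder formed by the elements `ab n`,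
`ac n` and `bc n`. The lemma covers the antichains with an `a`, a `b` and an element of the
ladder. -/
theorem stabilizesInTwo_a_b_join {m n i j : ℕ} (hij : i ≤ j + 1) (hji : j ≤ i + 1)
    (hm : m < i) (hn : n < j) : StabilizesInTwo (a m) (b n) (join i j) := by
  have e : tripleStep (a m, b n, join i j) = (join m j, join i n, join i j) := by
    simp only [tripleStep, Prod.mk.injEq, join, sup_eq, inf_eq]
    split_ifs <;> simp only [inf, sup, join] <;> grind
  exact stabilizesInTwo_of_tripleStep_eq e <|
    iterate_two_tripleStep_of_le_of_le (join_le_join hm.le le_rfl) (join_le_join le_rfl hn.le)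

theorem stabilizesInTwo_a_ac_bc {m i : ℕ} (h : m < i) : StabilizesInTwo (a m) (ac i) (bc i) := by
  have e : tripleStep (a m, ac i, bc i) = (ac m, ac i, ab i) := by
    simp only [tripleStep, Prod.mk.injEq, sup_eq, inf_eq, inf, sup, join]
    grind
  exact stabilizesInTwo_of_tripleStep_eq e <|
    iterate_two_tripleStep_of_le_of_le' (le_refl i) (Nat.succ_le_of_lt h)

theorem stabilizesInTwo_b_bc_ac {m i : ℕ} (h : m < i) : StabilizesInTwo (b m) (bc i) (ac i) := by
  have e : tripleStep (b m, bc i, ac i) = (bc m, bc i, ab i) := by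
    simp only [tripleStep, Prod.mk.injEq, sup_eq, inf_eq, inf, sup, join]
    grind
  exact stabilizesInTwo_of_tripleStep_eq e <|
    iterate_two_tripleStep_of_le_of_le' (le_refl i) (Nat.succ_le_of_lt h)

/-- A numbering of the seven kinds of elements of `K`. -/
def kind : K → ℕ
  | zero => 0
  | a _ => 1
  | b _ => 2
  | c => 3
  | ab _ => 4
  | ac _ => 5
  | bc _ => 6

theorem stabilizesInTwo_of_kind_le {x y z : K} (hxy : kind x ≤ kind y)
    (hyz : kind y ≤ kind z) : StabilizesInTwo x y z := by
  by_cases h₁ : x ≤ y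
  · exact stabilizesInTwo_of_le z h₁
  by_cases h₂ : y ≤ x
  · exact (stabilizesInTwo_of_le z h₂).swap
  by_cases h₃ : y ≤ z
  · exact (stabilizesInTwo_of_le x h₃).rotate.rotate
  by_cases h₄ : z ≤ y
  · exact (stabilizesInTwo_of_le x h₄).swap.rotate.rotate
  by_cases h₅ : x ≤ z
  · exact (stabilizesInTwo_of_le y h₅).swap.rotate
  by_cases h₆ : z ≤ x
  · exact (stabilizesInTwo_of_le y h₆).rotate
  -- Comparing indices leaves only the antichains treated above.
  rw [le_iff] at h₁ h₂ h₃ h₄ h₅ h₆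
  cases x <;> cases y <;> simp [kind, le] at hxy h₁ h₂ <;> try omega
  all_goals cases z <;> simp [kind, le] at hyz h₃ h₄ h₅ h₆ <;> try omega
  case neg.a.b.c m n => exact stabilizesInTwo_a_b_c m n
  case neg.a.b.ab m n i =>
    have := stabilizesInTwo_a_b_join i.le_succ i.le_succ h₅ h₃
    rwa [join, if_pos rfl] at this
  case neg.a.b.ac m n i =>
    have := stabilizesInTwo_a_b_join (n := n) (i := i) (j := i + 1) (by omega) le_rfl h₅ (by omega)
    rwa [join, if_neg (by omega), if_pos (by omega)] at this
  case neg.a.b.bc m n i =>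
    have := stabilizesInTwo_a_b_join (m := m) (i := i + 1) (j := i) le_rfl (by omega) (by omega) h₃
    rwa [join, if_neg (by omega), if_neg (by omega)] at this
  case neg.a.ac.bc m i j =>
    obtain rfl : i = j := le_antisymm h₃ h₄
    exact stabilizesInTwo_a_ac_bc h₁
  case neg.b.ac.bc m i j =>
    obtain rfl : i = j := le_antisymm h₃ h₄
    exact (stabilizesInTwo_b_bc_ac h₅).swap.rotate

/-- Permuting the entries of a triple does not affect stabilization, so they may be taken in
increasing order of kind. -/
theorem isHModular_two : IsHModular 2 K := by
  rintro ⟨x, y, z⟩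
  change StabilizesInTwo x y z
  rcases le_total (kind x) (kind y) with h₁ | h₁ <;>
    rcases le_total (kind y) (kind z) with h₂ | h₂ <;>
    rcases le_total (kind x) (kind z) with h₃ | h₃
  · exact stabilizesInTwo_of_kind_le h₁ h₂
  · exact stabilizesInTwo_of_kind_le h₁ h₂
  · exact (stabilizesInTwo_of_kind_le h₃ h₂).swap.rotate
  · exact (stabilizesInTwo_of_kind_le h₃ h₁).rotate
  · exact (stabilizesInTwo_of_kind_le h₁ h₃).swap
  · exact (stabilizesInTwo_of_kind_le h₂ h₃).rotate.rotate
  · exact (stabilizesInTwo_of_kind_le h₂ h₁).swap.rotate.rotate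
  · exact (stabilizesInTwo_of_kind_le h₂ h₁).swap.rotate.rotate

end K

/-! ### Compact bi-ideals -/

section BiIdeals

variable {A B : Type*} [SemilatticeSup A] [OrderBot A]

theorem BiIdeal.mem_bot [SemilatticeSup B] [OrderBot B] (I : BiIdeal A B) (a : A) :
    (a, (⊥ : B)) ∈ I.carrier :=
  I.botSet_subset (Or.inl rfl)

theorem BiIdeal.mem_of_le_sup [Lattice B] [OrderBot B] (I : BiIdeal A B) {p q r : A} {l m : B}
    (hp : (p, l) ∈ I.carrier) (hq : (q, m) ∈ I.carrier) (h : r ≤ p ⊔ q) :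
    (r, l ⊓ m) ∈ I.carrier :=
  I.lower (Prod.mk_le_mk.2 ⟨h, le_rfl⟩) <|
    I.sup_left p q (l ⊓ m) (I.lower (Prod.mk_le_mk.2 ⟨le_rfl, inf_le_left⟩) hp)
      (I.lower (Prod.mk_le_mk.2 ⟨le_rfl, inf_le_right⟩) hq)

theorem BiIdeal.mem_finset_sup [SemilatticeSup B] [OrderBot B] (I : BiIdeal A B) (p : A)
    {ι : Type*} (s : Finset ι) (f : ι → B) (h : ∀ i ∈ s, (p, f i) ∈ I.carrier) :
    (p, s.sup f) ∈ I.carrier :=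
  Finset.sup_induction (p := fun l => (p, l) ∈ I.carrier) (I.mem_bot p)
    (fun l hl m hm => I.sup_right p l m hl hm) h

/-- A compact bi-ideal is generated by finitely many of its elements. -/
theorem BiIdeal.exists_finset_generates [SemilatticeSup B] [OrderBot B] {I : BiIdeal A B}
    (hI : IsCompactElement I) :
    ∃ Γ : Finset (A × B), (Γ : Set (A × B)) ⊆ I.carrier ∧
      ∀ J : BiIdeal A B, (Γ : Set (A × B)) ⊆ J.carrier → I ≤ J := by
  classical
  -- `pure p` is the principal bi-ideal generated by `p`.
  let pure : A × B → BiIdeal A B := fun p => sInf {J | p ∈ J.carrier}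
  have mem_pure : ∀ p, p ∈ (pure p).carrier := fun p J hJ => hJ
  have hle : I ≤ sSup (pure '' I.carrier) := fun p hp =>
    le_sSup (Set.mem_image_of_mem pure hp) (mem_pure p)
  obtain ⟨t, ht, hIt⟩ :=
    (CompleteLattice.isCompactElement_iff_exists_le_sSup_of_le_sSup _ I).1 hI _ hle
  obtain ⟨Γ, hΓ, rfl⟩ := Finset.subset_set_image_iff.1 ht
  refine ⟨Γ, hΓ, fun J hJ => hIt.trans (Finset.sup_le fun q hq => ?_)⟩
  obtain ⟨p, hp, rfl⟩ := Finset.mem_image.1 hq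
  exact sInf_le (hJ hp)

end BiIdeals

/-- Along a descending sequence `p` in `K`, a finite subset `Γ` of `I` yields coefficients `f n`
bounding all `l` with `⟨k, l⟩ ∈ Γ` and `p n ≤ k`, namely the joins of these `l`. They increase,
and since `Γ` is finite they are eventually constant. -/
theorem exists_eventually_const_coeff {L : Type*} [Lattice L] [OrderBot L] (I : BiIdeal K L)
    (Γ : Finset (K × L)) (hΓ : (Γ : Set (K × L)) ⊆ I.carrier) (p : ℕ → K) (hp : Antitone p) :
    ∃ f : ℕ → L, Monotone f ∧ (∃ N, ∀ n, N ≤ n → f n = f N) ∧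
      (∀ n, (p n, f n) ∈ I.carrier) ∧ ∀ q ∈ Γ, ∀ n, p n ≤ q.1 → q.2 ≤ f n := by
  classical
  have hev : ∀ q ∈ Γ, ∀ᶠ N in Filter.atTop, ∀ n, p n ≤ q.1 → p N ≤ q.1 := by
    intro q _
    by_cases h : ∃ m, p m ≤ q.1
    · obtain ⟨m, hm⟩ := h
      filter_upwards [Filter.eventually_ge_atTop m] with N hN n _
      exact (hp hN).trans hm
    · exact Filter.Eventually.of_forall fun N n hn => (h ⟨n, hn⟩).elim
  obtain ⟨N, hN⟩ := ((Filter.eventually_all_finset Γ).2 hev).exists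
  have hmono : Monotone fun n => (Γ.filter fun q => p n ≤ q.1).sup Prod.snd := fun m n hmn =>
    Finset.sup_mono <| Finset.monotone_filter_right _ fun q _ hq => (hp hmn).trans hq
  refine ⟨_, hmono, ⟨N, fun n hn => ?_⟩, fun n => ?_, fun q hq n hn => ?_⟩
  · refine le_antisymm (Finset.sup_mono fun q hq => ?_) (hmono hn)
    rw [Finset.mem_filter] at hq ⊢
    exact ⟨hq.1, hN q hq.1 n hq.2⟩
  · refine I.mem_finset_sup _ _ _ fun q hq => ?_
    rw [Finset.mem_filter] at hq
    exact I.lower (Prod.mk_le_mk.2 ⟨hq.2, le_rfl⟩) (hΓ hq.1)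
  · exact Finset.le_sup (f := Prod.snd) (Finset.mem_filter.2 ⟨hq, hn⟩)

/-! ### Saturating a pair of sequences -/

section Climb

variable {L : Type*} [Lattice L]

/-- The smallest pair of increasing sequences `x ≥ α`, `y ≥ β` with `y n ∧ z ≤ x (n + 1)` and
`x n ∧ z ≤ y (n + 1)`, encoded as one sequence of pairs. -/
def climb (α β : ℕ → L) (z : L) : ℕ → L × L
  | 0 => (α 0, β 0)
  | n + 1 =>
    (α (n + 1) ⊔ ((climb α β z n).1 ⊔ (climb α β z n).2 ⊓ z),
      β (n + 1) ⊔ ((climb α β z n).2 ⊔ (climb α β z n).1 ⊓ z))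

theorem monotone_climb (α β : ℕ → L) (z : L) : Monotone (climb α β z) :=
  monotone_nat_of_le_succ fun _ =>
    Prod.mk_le_mk.2 ⟨le_sup_left.trans le_sup_right, le_sup_left.trans le_sup_right⟩

theorem le_climb (α β : ℕ → L) (z : L) (n : ℕ) : (α n, β n) ≤ climb α β z n := by
  cases n with
  | zero => exact le_rfl
  | succ n => exact Prod.mk_le_mk.2 ⟨le_sup_left, le_sup_left⟩

theorem climb_le {α β : ℕ → L} {x y z : L} (hα : ∀ n, α n ≤ x) (hβ : ∀ n, β n ≤ y)
    (hfix : tripleStep (x, y, z) = (x, y, z)) (n : ℕ) : climb α β z n ≤ (x, y) := by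
  simp only [tripleStep, Prod.mk.injEq, sup_eq_left] at hfix
  induction n with
  | zero => exact Prod.mk_le_mk.2 ⟨hα 0, hβ 0⟩
  | succ n ih =>
    exact Prod.mk_le_mk.2
      ⟨sup_le (hα _) (sup_le ih.1 ((inf_le_inf_right z ih.2).trans hfix.1)),
        sup_le (hβ _) (sup_le ih.2 ((inf_le_inf_right z ih.1).trans hfix.2.1))⟩

/-- One step of `climb` does at least as much as one application of `tripleStep` whose third entry is
bounded by `z`, so `climb` reaches the `h`-th iterate at most `h` terms after `N`. -/
theorem iterate_tripleStep_le_climb {α β : ℕ → L} {γ z : L} {N h : ℕ}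
    (hz : ∀ k ≤ h, (tripleStep^[k] (α N, β N, γ)).2.2 ≤ z) :
    ∀ k ≤ h, (tripleStep^[k] (α N, β N, γ)).1 ≤ (climb α β z (N + k)).1 ∧
      (tripleStep^[k] (α N, β N, γ)).2.1 ≤ (climb α β z (N + k)).2 := by
  intro k
  induction k with
  | zero => exact fun _ => le_climb α β z N
  | succ k ih =>
    intro hk
    obtain ⟨h₁, h₂⟩ := ih (by omega)
    have h₃ := hz k (by omega)
    rw [Function.iterate_succ_apply']
    exact ⟨le_trans (sup_le_sup h₁ (inf_le_inf h₂ h₃)) le_sup_right,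
      le_trans (sup_le_sup h₂ (inf_le_inf h₁ h₃)) le_sup_right⟩

end Climb

/-! ### Bi-ideals of `K × L` -/

namespace K

section Saturated

variable {L : Type*} [Lattice L] [OrderBot L]

/-- The three relations `a (n + 1) ≤ b n ∨ c`, `b (n + 1) ≤ a n ∨ c` and `c ≤ a n ∨ b n` turn a common
tail value of each chain and a value at `c` into those given by `tripleStep`, at the cost of
shifting the tail by one. -/
theorem iterate_tripleStep_mem (I : BiIdeal K L) {x y z : L} {N : ℕ}
    (hx : ∀ n, N ≤ n → (a n, x) ∈ I.carrier) (hy : ∀ n, N ≤ n → (b n, y) ∈ I.carrier)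
    (hz : (c, z) ∈ I.carrier) (k : ℕ) :
    (∀ n, N + k ≤ n → (a n, (tripleStep^[k] (x, y, z)).1) ∈ I.carrier) ∧
      (∀ n, N + k ≤ n → (b n, (tripleStep^[k] (x, y, z)).2.1) ∈ I.carrier) ∧
      (c, (tripleStep^[k] (x, y, z)).2.2) ∈ I.carrier := by
  induction k with
  | zero => exact ⟨hx, hy, hz⟩
  | succ k ih =>
    obtain ⟨h₁, h₂, h₃⟩ := ih
    rw [Function.iterate_succ_apply']
    refine ⟨fun n hn => ?_, fun n hn => ?_, ?_⟩
    · obtain ⟨n, rfl⟩ : ∃ m, n = m + 1 := ⟨n - 1, by omega⟩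
      exact I.sup_right _ _ _ (h₁ _ (by omega))
        (I.mem_of_le_sup (h₂ n (by omega)) h₃ (le_refl (n + 1)))
    · obtain ⟨n, rfl⟩ : ∃ m, n = m + 1 := ⟨n - 1, by omega⟩
      exact I.sup_right _ _ _ (h₂ _ (by omega))
        (I.mem_of_le_sup (h₁ n (by omega)) h₃ (le_refl (n + 1)))
    · refine I.sup_right _ _ _ h₃
        (I.mem_of_le_sup (h₁ (N + k) le_rfl) (h₂ (N + k) le_rfl) ?_)
      rw [sup_eq, sup, join, if_pos rfl]
      trivial

theorem climb_mem (I : BiIdeal K L) {α β : ℕ → L} {z : L}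
    (hα : ∀ n, (a n, α n) ∈ I.carrier) (hβ : ∀ n, (b n, β n) ∈ I.carrier)
    (hz : (c, z) ∈ I.carrier) (n : ℕ) :
    (a n, (climb α β z n).1) ∈ I.carrier ∧ (b n, (climb α β z n).2) ∈ I.carrier := by
  induction n with
  | zero => exact ⟨hα 0, hβ 0⟩
  | succ n ih =>
    exact ⟨I.sup_right _ _ _ (hα _) (I.sup_right _ _ _
        (I.lower (Prod.mk_le_mk.2 ⟨antitone_a n.le_succ, le_rfl⟩) ih.1)
        (I.mem_of_le_sup ih.2 hz (le_refl (n + 1)))),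
      I.sup_right _ _ _ (hβ _) (I.sup_right _ _ _
        (I.lower (Prod.mk_le_mk.2 ⟨antitone_b n.le_succ, le_rfl⟩) ih.2)
        (I.mem_of_le_sup ih.1 hz (le_refl (n + 1))))⟩

/-- The conditions under which `x n`, `y n`, `z` are the largest second coordinates that occur with
first coordinate `a n`, `b n`, `c`, respectively, in some bi-ideal of `K × L`. -/
structure IsSaturated (x y : ℕ → L) (z : L) : Prop where
  monotone_x : Monotone x
  monotone_y : Monotone y
  inf_le_z : ∀ m n, x m ⊓ y n ≤ z
  inf_le_x : ∀ n, y n ⊓ z ≤ x (n + 1)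
  inf_le_y : ∀ n, x n ⊓ z ≤ y (n + 1)

/-- The bi-ideal with largest second coordinates `x n`, `y n`, `z` over the join-irreducible elements
`a n`, `b n`, `c`; over any other nonzero `k` they are bounded by the values at all
join-irreducible elements below `k`. -/
def IsSaturated.biIdeal {x y : ℕ → L} {z : L} (h : IsSaturated x y z) : BiIdeal K L where
  carrier := {p | (∀ n, a n ≤ p.1 → p.2 ≤ x n) ∧ (∀ n, b n ≤ p.1 → p.2 ≤ y n) ∧
    (c ≤ p.1 → p.2 ≤ z)}
  lower := fun p q hqp hp => ⟨fun n hn => hqp.2.trans (hp.1 n (hn.trans hqp.1)),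
    fun n hn => hqp.2.trans (hp.2.1 n (hn.trans hqp.1)),
    fun hc => hqp.2.trans (hp.2.2 (hc.trans hqp.1))⟩
  botSet_subset := by
    rintro ⟨k, l⟩ (rfl | rfl)
    · exact ⟨fun _ _ => bot_le, fun _ _ => bot_le, fun _ => bot_le⟩
    · exact ⟨fun _ hn => hn.elim, fun _ hn => hn.elim, fun hc => hc.elim⟩
  sup_left := by
    rintro k₀ k₁ l ⟨ha₀, hb₀, hc₀⟩ ⟨ha₁, hb₁, hc₁⟩
    have hz : c ≤ k₀ ⊔ k₁ → l ≤ z := fun hc => by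
      rcases c_le_sup hc with hc | hc | ⟨m, n, ⟨hm, hn⟩ | ⟨hn, hm⟩⟩
      · exact hc₀ hc
      · exact hc₁ hc
      · exact (le_inf (ha₀ m hm) (hb₁ n hn)).trans (h.inf_le_z m n)
      · exact (le_inf (ha₁ m hm) (hb₀ n hn)).trans (h.inf_le_z m n)
    refine ⟨fun n hn => ?_, fun n hn => ?_, hz⟩
    · rcases a_le_sup hn with hn | hn | ⟨m, rfl, hc, hm | hm⟩
      · exact ha₀ n hn
      · exact ha₁ n hn
      · exact (le_inf (hb₀ m hm) (hz hc)).trans (h.inf_le_x m)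
      · exact (le_inf (hb₁ m hm) (hz hc)).trans (h.inf_le_x m)
    · rcases b_le_sup hn with hn | hn | ⟨m, rfl, hc, hm | hm⟩
      · exact hb₀ n hn
      · exact hb₁ n hn
      · exact (le_inf (ha₀ m hm) (hz hc)).trans (h.inf_le_y m)
      · exact (le_inf (ha₁ m hm) (hz hc)).trans (h.inf_le_y m)
  sup_right := fun k l₀ l₁ h₀ h₁ => ⟨fun n hn => sup_le (h₀.1 n hn) (h₁.1 n hn),
    fun n hn => sup_le (h₀.2.1 n hn) (h₁.2.1 n hn), fun hc => sup_le (h₀.2.2 hc) (h₁.2.2 hc)⟩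

/-- Since the chains and the ladder in `K` descend, eventual constancy of the coefficients leaves only
finitely many maximal elements of the bi-ideal outside `⊥_{K,L}`. -/
theorem isCapped_of_le_biIdeal {I : BiIdeal K L} {x y : ℕ → L} {z : L} (h : IsSaturated x y z)
    (hI : I ≤ h.biIdeal) (hx : ∀ n, (a n, x n) ∈ I.carrier) (hy : ∀ n, (b n, y n) ∈ I.carrier)
    (hz : (c, z) ∈ I.carrier) {M : ℕ} (hxM : ∀ n, M ≤ n → x n = x M)
    (hyM : ∀ n, M ≤ n → y n = y M) : I.IsCapped := by
  have hx' : ∀ n, x (min n M) = x n := fun n => by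
    rcases le_total n M with hn | hn
    · rw [min_eq_left hn]
    · rw [min_eq_right hn, hxM n hn]
  have hy' : ∀ n, y (min n M) = y n := fun n => by
    rcases le_total n M with hn | hn
    · rw [min_eq_left hn]
    · rw [min_eq_right hn, hyM n hn]
  -- The part of the capping over the elements of `K` with index `n`.
  let S : ℕ → Set (K × L) := fun n =>
    {(a n, x n), (b n, y n), (ab n, x n ⊓ y n), (ac n, x n ⊓ z), (bc n, y n ⊓ z)}
  have hfin : (insert (c, z) (⋃ n ∈ Set.Iic M, S n)).Finite :=
    ((Set.finite_Iic M).biUnion fun n _ => by simp [S]).insert _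
  refine ⟨_, hfin, Set.Subset.antisymm ?_ ?_⟩
  · have hS : ∀ n, ∀ q ∈ S (min n M), q ∈ insert (c, z) (⋃ n ∈ Set.Iic M, S n) := fun n q hq =>
      Set.mem_insert_of_mem _ (Set.mem_biUnion (Set.mem_Iic.2 (min_le_right n M)) hq)
    have key : ∀ (k k' : K) (l l' : L), (k', l') ∈ insert (c, z) (⋃ n ∈ Set.Iic M, S n) →
        k ≤ k' → l ≤ l' → (k, l) ∈ lowerClosure
          (insert (c, z) (⋃ n ∈ Set.Iic M, S n) ∪ botSet K L) :=
      fun k k' l l' hm hk hl => ⟨(k', l'), Or.inl hm, hk, hl⟩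
    rintro ⟨k, l⟩ hkl
    obtain ⟨ha, hb, hc⟩ := hI hkl
    cases k with
    | zero => exact subset_lowerClosure (Or.inr (Or.inr rfl))
    | c => exact key _ c _ z (Set.mem_insert _ _) le_rfl (hc le_rfl)
    | a n =>
      refine key _ (a (min n M)) _ (x (min n M)) (hS n _ (by simp [S])) (min_le_left n M) ?_
      rw [hx']
      exact ha n le_rfl
    | b n =>
      refine key _ (b (min n M)) _ (y (min n M)) (hS n _ (by simp [S])) (min_le_left n M) ?_
      rw [hy']
      exact hb n le_rfl
    | ab n =>
      refine key _ (ab (min n M)) _ (x (min n M) ⊓ y (min n M)) (hS n _ (by simp [S]))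
        (min_le_left n M) ?_
      rw [hx', hy']
      exact le_inf (ha n (le_refl n)) (hb n (le_refl n))
    | ac n =>
      refine key _ (ac (min n M)) _ (x (min n M) ⊓ z) (hS n _ (by simp [S]))
        (min_le_left n M) ?_
      rw [hx']
      exact le_inf (ha n (le_refl n)) (hc trivial)
    | bc n =>
      refine key _ (bc (min n M)) _ (y (min n M) ⊓ z) (hS n _ (by simp [S]))
        (min_le_left n M) ?_
      rw [hy']
      exact le_inf (hb n (le_refl n)) (hc trivial)
  · refine lowerClosure_min (Set.union_subset (Set.insert_subset hz ?_) I.botSet_subset) I.lower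
    refine Set.iUnion₂_subset fun n _ => ?_
    have hab : ab n ≤ a n ⊔ b n := by simp [sup_eq, sup, join]
    rintro q (rfl | rfl | rfl | rfl | rfl)
    · exact hx n
    · exact hy n
    · exact I.mem_of_le_sup (hx n) (hy n) hab
    · exact I.mem_of_le_sup (hx n) hz (le_refl (ac n))
    · exact I.mem_of_le_sup (hy n) hz (le_refl (bc n))

end Saturated

theorem isAmenableFor_isHModular (h : ℕ) :
    IsAmenableFor.{u} (fun L _ => IsHModular h L) K := by
  rintro L _ _ hL ⟨I, hI⟩
  obtain ⟨Γ, hΓI, hΓ⟩ := BiIdeal.exists_finset_generates hI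
  obtain ⟨α, hα, ⟨N₁, hN₁⟩, hαI, hαΓ⟩ :=
    exists_eventually_const_coeff I Γ hΓI a antitone_a
  obtain ⟨β, hβ, ⟨N₂, hN₂⟩, hβI, hβΓ⟩ :=
    exists_eventually_const_coeff I Γ hΓI b antitone_b
  obtain ⟨γ, -, -, hγI, hγΓ⟩ :=
    exists_eventually_const_coeff I Γ hΓI (fun _ => c) antitone_const
  obtain ⟨N, hαN, hβN⟩ : ∃ N, (∀ n, N ≤ n → α n = α N) ∧ ∀ n, N ≤ n → β n = β N :=
    ⟨max N₁ N₂, fun n hn => by rw [hN₁ n (by omega), hN₁ (max N₁ N₂) (by omega)],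
      fun n hn => by rw [hN₂ n (by omega), hN₂ (max N₁ N₂) (by omega)]⟩
  -- The limit values of the saturated coefficients; `h`-modularity of `L` makes them a fixed
  -- triple.
  obtain ⟨⟨x, y, z⟩, huv⟩ : ∃ v, v = tripleStep^[h] (α N, β N, γ 0) := ⟨_, rfl⟩
  have hfix : tripleStep (x, y, z) = (x, y, z) := by
    rw [huv, ← Function.iterate_succ_apply' tripleStep]
    exact hL _
  have hle : ∀ k ≤ h, tripleStep^[k] (α N, β N, γ 0) ≤ (x, y, z) := fun k hk => by
    rw [huv]
    exact Function.monotone_iterate_of_id_le le_tripleStep hk _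
  have hαx : ∀ n, α n ≤ x := fun n => (hα (le_max_left n N)).trans <| by
    rw [hαN _ (le_max_right n N)]
    exact (hle 0 h.zero_le).1
  have hβy : ∀ n, β n ≤ y := fun n => (hβ (le_max_left n N)).trans <| by
    rw [hβN _ (le_max_right n N)]
    exact (hle 0 h.zero_le).2.1
  have hzI : (c, z) ∈ I.carrier := by
    have := (iterate_tripleStep_mem I (fun n hn => hαN n hn ▸ hαI n)
      (fun n hn => hβN n hn ▸ hβI n) (hγI 0) h).2.2
    rwa [← huv] at this
  have hup := climb_le hαx hβy hfix
  have hlow : (x, y) ≤ climb α β z (N + h) := by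
    have := iterate_tripleStep_le_climb (fun k hk => (hle k hk).2.2) h le_rfl
    rwa [← huv] at this
  have hconst : ∀ n, N + h ≤ n → climb α β z n = climb α β z (N + h) := fun n hn =>
    ((hup n).trans hlow).antisymm (monotone_climb α β z hn)
  have hsat : IsSaturated (fun n => (climb α β z n).1) (fun n => (climb α β z n).2) z := by
    refine ⟨fun m n hmn => (monotone_climb α β z hmn).1,
      fun m n hmn => (monotone_climb α β z hmn).2, fun m n => ?_,
      fun n => le_sup_right.trans le_sup_right, fun n => le_sup_right.trans le_sup_right⟩
    exact (inf_le_inf (hup m).1 (hup n).2).trans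
      (sup_eq_left.1 (congrArg (fun u => u.2.2) hfix))
  have hclimb := climb_mem I hαI hβI hzI
  refine isCapped_of_le_biIdeal hsat (hΓ _ ?_) (fun n => (hclimb n).1) (fun n => (hclimb n).2) hzI
    (fun n hn => congrArg Prod.fst (hconst n hn)) (fun n hn => congrArg Prod.snd (hconst n hn))
  exact fun q hq => ⟨fun n hn => (hαΓ q hq n hn).trans (le_climb α β z n).1,
    fun n hn => (hβΓ q hq n hn).trans (le_climb α β z n).2,
    fun hc => (hγΓ q hq 0 hc).trans (hle 0 h.zero_le).2.2⟩

/-! ### Generation of `K` -/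

theorem latticeClosure_a_b_c : latticeClosure {a 0, b 0, c} = (Set.univ : Set K) := by
  have hS : IsSublattice (latticeClosure {a 0, b 0, c} : Set K) := isSublattice_latticeClosure
  have hsub : ({a 0, b 0, c} : Set K) ⊆ latticeClosure {a 0, b 0, c} := subset_latticeClosure
  have ha0 := hsub (by simp : a 0 ∈ _)
  have hb0 := hsub (by simp : b 0 ∈ _)
  have hc := hsub (by simp : c ∈ _)
  generalize latticeClosure {a 0, b 0, c} = S at *
  have hab : ∀ n, a n ∈ S ∧ b n ∈ S := fun n => by
    induction n with
    | zero => exact ⟨ha0, hb0⟩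
    | succ n ih =>
      have e₁ : a 0 ⊓ (b n ⊔ c) = a (n + 1) := by simp [sup_eq, sup, inf_eq, inf]
      have e₂ : b 0 ⊓ (a n ⊔ c) = b (n + 1) := by simp [sup_eq, sup, inf_eq, inf]
      exact ⟨e₁ ▸ hS.infClosed ha0 (hS.supClosed ih.2 hc),
        e₂ ▸ hS.infClosed hb0 (hS.supClosed ih.1 hc)⟩
  refine Set.eq_univ_of_forall fun k => ?_
  cases k with
  | zero => exact hS.infClosed ha0 hc
  | a n => exact (hab n).1
  | b n => exact (hab n).2
  | c => exact hc
  | ab n =>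
    have e : a n ⊔ b n = ab n := by simp [sup_eq, sup, join]
    exact e ▸ hS.supClosed (hab n).1 (hab n).2
  | ac n => exact hS.supClosed (hab n).1 hc
  | bc n => exact hS.supClosed (hab n).2 hc

instance : Infinite K := Infinite.of_injective a fun _ _ => K.a.inj

theorem isNGenerated_three : IsNGenerated 3 K := by
  classical
  refine ⟨{a 0, b 0, c}, ?_, ?_⟩
  · simp
  · rw [← latticeClosure_a_b_c]
    simp

theorem not_isLocallyFinite : ¬ IsLocallyFinite K := fun h =>
  Set.infinite_univ (latticeClosure_a_b_c ▸ h {a 0, b 0, c} (by simp))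

end K
end CappedTensor

/-- `K` is infinite, three-generated, `2`-modular, not locally finite, and `K ⊗ L` is a capped
tensor product for every `h > 0` and every `h`-modular lattice `L` with zero. -/
theorem theorem5p12 :
    (Infinite CappedTensor.K ∧ CappedTensor.IsNGenerated 3 CappedTensor.K ∧
      CappedTensor.IsHModular 2 CappedTensor.K) ∧
    (∀ h : ℕ, 0 < h →
      CappedTensor.IsAmenableFor.{u} (fun L _ => CappedTensor.IsHModular h L) CappedTensor.K) ∧
    ¬ CappedTensor.IsLocallyFinite CappedTensor.K := by
  exact ⟨⟨inferInstance, CappedTensor.K.isNGenerated_three, CappedTensor.K.isHModular_two⟩,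
    fun h _ => CappedTensor.K.isAmenableFor_isHModular h, CappedTensor.K.not_isLocallyFinite⟩
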